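/- Let $k\ge 1$, let $S$ be a countably infinite set, let $K$ be a standard Borel space, and write $\binom{V}{j}$ for the set of $j$-element subsets of a set $V$. Let $\mu$ be a probability measure on $K^{\binom{S}{k}}$ that is exchangeable, i.e. for every finitely supported permutation $g$ of $S$ it is invariant under the map $(\omega_e)_{e\in\binom Sk}\mapsto(\omega_{g(e)})_{e\in\binom Sk}$. Then there are standard Borel spaces $Z_0,Z_1,\dots,Z_{k-1}$, a probability measure $\mu_0$ on $Z_0$ and, setting $Z_k:=K$, for each $i=1,\dots,k$ a probability kernel $$P_i : \prod_{j=0}^{i-1} Z_j^{\binom{[i]}{j}} = Z_0\times Z_1^{i}\times Z_2^{\binom i2}\times\cdots\times Z_{i-1}^{\binom{i}{i-1}} \rightsquigarrow Z_i$$ that is invariant under the coordinate-permuting action of $\mathrm{Sym}([i])$ on its domain, such that $\mu$ is the law of the family $(z_e)_{e\in\binom Sk}$ produced by the following recipe. Choose $z_\emptyset\in Z_0$ with law $\mu_0$. Then, successively for $i=1,2,\dots,k$, conditionally on the colours $z_a$ of all subsets $a\subset S$ with $|a|<i$, choose the colours $z_e\in Z_i$, $e\in\binom Si$, independently, with $z_e$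 having law $P_i\big((z_a)_{a\subsetneq e},\cdot\big)$, where $(z_a)_{a\subsetneq e}$ is regarded as a point of the domain of $P_i$ through any bijection $[i]\to e$ (by the symmetry of $P_i$ the choice of the bijection does not matter). -/

import Mathlib

open MeasureTheory ProbabilityTheory

universe u v w

namespace ExchHyp

/-- The coordinate map `τ^f` induced by an injection `f : V ↪ W` on colourings of `k`-subsets:
`(ω_e)_e ↦ (ω_{f(e)})_e`. -/
def relabel {V : Type v} {W : Type w} {K : Type u} {k : ℕ} (f : V ↪ W)
    (ω : Set.powersetCard W k → K) : Set.powersetCard V k → K :=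
  fun e => ω (Set.powersetCard.map k f e)

/-- A law on `K ^ (S choose k)` is exchangeable if it is a probability measure that is invariant
under the action of all finitely supported permutations of the vertex set `S`. -/
structure IsExchangeable {S : Type v} {K : Type u} [MeasurableSpace K] {k : ℕ}
    (μ : Measure (Set.powersetCard S k → K)) : Prop where
  isProbabilityMeasure : IsProbabilityMeasure μ
  map_relabel : ∀ g : Equiv.Perm S, {s | g s ≠ s}.Finite →
    μ.map (relabel g.toEmbedding) = μ

/-- The space `Z_0 × Z_1 ^ V × Z_2 ^ (V choose 2) × ⋯ × Z_{n-1} ^ (V choose (n-1))` of colourings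
of all subsets of `V` of size `< n`, where sets of size `j` get a colour in `Z j`. -/
abbrev Lower (Z : ℕ → Type u) (n : ℕ) (V : Type v) : Type (max u v) :=
  (j : Fin n) → Set.powersetCard V (j : ℕ) → Z j

namespace Lower

variable {Z : ℕ → Type u} {n : ℕ} {V : Type v} {W : Type w}

/-- The coordinate map `(z_a)_a ↦ (z_{f(a)})_a` induced by an injection `f : V ↪ W`. -/
def pull (f : V ↪ W) (z : Lower Z n W) : Lower Z n V :=
  fun j => relabel f (z j)

/-- Adjoin colours of the `n`-subsets to a colouring of the subsets of size `< n`. -/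
def snoc (z : Lower Z n V × (Set.powersetCard V n → Z n)) : Lower Z (n + 1) V :=
  Fin.snoc (α := fun j : Fin (n + 1) => Set.powersetCard V (j : ℕ) → Z j) z.1 z.2

variable [∀ i, MeasurableSpace (Z i)]

theorem measurable_pull (f : V ↪ W) : Measurable (pull f : Lower Z n W → Lower Z n V) := by
  unfold pull relabel
  fun_prop

theorem measurable_snoc : Measurable (snoc : _ → Lower Z (n + 1) V) := by
  refine measurable_pi_lambda _ fun j => ?_
  refine Fin.lastCases ?_ (fun i => ?_) j
  · simp only [snoc, Fin.snoc_last]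
    exact measurable_snd
  · simp only [snoc, Fin.snoc_castSucc]
    exact (measurable_pi_apply i).comp measurable_fst

end Lower

/-- The kernel `⨂_{i ∈ ι} κ_i`: given `x`, choose the coordinates independently, the `i`-th one
with law `κ_i(x, ·)`. -/
noncomputable def prodKernel {X : Type u} {ι : Type v} {Y : Type w} [MeasurableSpace X]
    [MeasurableSpace Y] (κ : ι → Kernel X Y) [∀ i, IsMarkovKernel (κ i)] :
    Kernel X (ι → Y) where
  toFun x := Measure.infinitePi fun i => κ i x
  measurable' := by
    classical
    refine Measurable.measure_of_isPiSystem_of_isProbabilityMeasure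
      generateFrom_squareCylinders.symm
      (isPiSystem_squareCylinders (fun _ => MeasurableSpace.isPiSystem_measurableSet)
        (fun _ => MeasurableSet.univ)) ?_
    rintro _ ⟨s, t, ht, rfl⟩
    have ht' : ∀ i, MeasurableSet (t i) := fun i => ht i (Set.mem_univ i)
    simp_rw [Measure.infinitePi_pi _ (fun i _ => ht' i)]
    exact Finset.measurable_prod _ fun i _ => (κ i).measurable_coe (ht' i)

instance {X : Type u} {ι : Type v} {Y : Type w} [MeasurableSpace X]
    [MeasurableSpace Y] (κ : ι → Kernel X Y) [∀ i, IsMarkovKernel (κ i)] :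
    IsMarkovKernel (prodKernel κ) :=
  ⟨fun x => by
    change IsProbabilityMeasure (Measure.infinitePi fun i => κ i x)
    infer_instance⟩

/-- A kernel on `Z_0 × Z_1 ^ i × ⋯ × Z_{i-1} ^ (i choose (i-1))` is symmetric if it is invariant
under the coordinate-permuting action of `Sym([i])` on its domain. -/
def IsSymmetric {Z : ℕ → Type u} [∀ i, MeasurableSpace (Z i)] {i : ℕ} {Y : Type w}
    [MeasurableSpace Y] (P : Kernel (Lower Z i (Fin i)) Y) : Prop :=
  ∀ (σ : Equiv.Perm (Fin i)) (z : Lower Z i (Fin i)), P (Lower.pull σ.toEmbedding z) = P z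

/-- An enumeration of the vertices of an `i`-subset. Which one is chosen does not matter when it is
used with a symmetric kernel. -/
noncomputable def enum {S : Type v} {i : ℕ} (e : Set.powersetCard S i) : Fin i ↪ S :=
  (Set.powersetCard.ofFinEmb_surjective i S e).choose

theorem ofFinEmb_enum {S : Type v} {i : ℕ} (e : Set.powersetCard S i) :
    Set.powersetCard.ofFinEmb i S (enum e) = e :=
  (Set.powersetCard.ofFinEmb_surjective i S e).choose_spec

/-- The kernel that, given colours `z_a` of all subsets `a` of `S` of size `< i`, chooses
independently a colour for each `i`-subset `e` of `S`, with law `P((z_a)_{a ⊊ e}, ·)`. -/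
noncomputable def edgeKernel {Z : ℕ → Type u} [∀ i, MeasurableSpace (Z i)] {i : ℕ} {Y : Type w}
    [MeasurableSpace Y] (S : Type v) (P : Kernel (Lower Z i (Fin i)) Y) [IsMarkovKernel P] :
    Kernel (Lower Z i S) (Set.powersetCard S i → Y) :=
  prodKernel fun e : Set.powersetCard S i => P.comap (Lower.pull (enum e))
    (Lower.measurable_pull (enum e))

/-- A sequence of ingredients `(Z_0, μ_0), (Z_1, P_1), …, (Z_{k-1}, P_{k-1}), (K, P_k)`.
Here `P i` is the kernel `P_{i+1}` into `Z_{i+1}`, and `top` is the last kernel `P_k` into `K`.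
For convenience the sequences `Z` and `P` are continued to all ranks; the terms of `Z` of
rank `≥ k` and the kernels into them take no part in the recipe for `K ^ (S choose k)`. -/
structure Ingredients (k : ℕ) (K : Type u) [MeasurableSpace K] where
  Z : ℕ → Type u
  [measurableSpace : ∀ i, MeasurableSpace (Z i)]
  [standardBorel : ∀ i, StandardBorelSpace (Z i)]
  μ₀ : Measure (Z 0)
  [isProbabilityMeasure : IsProbabilityMeasure μ₀]
  P : (i : ℕ) → Kernel (Lower Z (i + 1) (Fin (i + 1))) (Z (i + 1))
  [isMarkov : ∀ i, IsMarkovKernel (P i)]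
  symm : ∀ i, IsSymmetric (P i)
  top : Kernel (Lower Z k (Fin k)) K
  [isMarkov_top : IsMarkovKernel top]
  symm_top : IsSymmetric top

namespace Ingredients

attribute [instance] measurableSpace standardBorel isProbabilityMeasure isMarkov isMarkov_top

variable {k : ℕ} {K : Type u} [MeasurableSpace K] (I : Ingredients k K)

/-- The law on `Z_0 × Z_1 ^ S × ⋯ × Z_{n-1} ^ (S choose (n-1))` of the colours of all subsets of
size `< n` chosen by the standard recipe: the empty set gets a colour with law `μ₀`, and, once
all subsets of size `≤ n` are coloured, the `(n+1)`-subsets `e` get colours chosen independently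
according to `P_{n+1}((z_a)_{a ⊊ e}, ·)`. -/
noncomputable def law (S : Type v) : (n : ℕ) → Measure (Lower I.Z n S)
  | 0 => Measure.dirac fun j => j.elim0
  | 1 => I.μ₀.map fun z => Lower.snoc (n := 0) (fun j => j.elim0, fun _ => z)
  | n + 2 => (law S (n + 1) ⊗ₘ edgeKernel S (I.P n)).map Lower.snoc

/-- The law on `K ^ (S choose k)` of the outcome of the standard recipe. -/
noncomputable def recipe (S : Type v) : Measure (Set.powersetCard S k → K) :=
  (I.law S k).bind (edgeKernel S I.top)

/-- The ingredients yield the law `μ` upon following the standard recipe. -/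
def Yields {S : Type v} (μ : Measure (Set.powersetCard S k → K)) : Prop :=
  I.recipe S = μ

instance isProbabilityMeasure_law (S : Type v) : (n : ℕ) → IsProbabilityMeasure (I.law S n)
  | 0 => by unfold law; infer_instance
  | 1 => by
    unfold law
    refine Measure.isProbabilityMeasure_map (Measurable.aemeasurable ?_)
    exact Lower.measurable_snoc.comp (by fun_prop)
  | n + 2 => by
    have := isProbabilityMeasure_law S (n + 1)
    unfold law edgeKernel
    exact Measure.isProbabilityMeasure_map Lower.measurable_snoc.aemeasurable

end Ingredients

end ExchHyp

namespace ExchHyp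

/-- A finite measure on a product of copies of `Y` is determined by its values on finite-dimensional
boxes. -/
theorem measure_ext_of_boxes {ι : Type v} {Y : Type w} [MeasurableSpace Y] {μ ν : Measure (ι → Y)}
    [IsFiniteMeasure μ]
    (h : ∀ (s : Finset ι) (t : ι → Set Y), (∀ i, MeasurableSet (t i)) →
      μ (Set.pi s t) = ν (Set.pi s t)) : μ = ν := by
  refine ext_of_generate_finite _ generateFrom_squareCylinders.symm
    (isPiSystem_squareCylinders (fun _ => MeasurableSpace.isPiSystem_measurableSet)
        (fun _ => MeasurableSet.univ)) ?_ ?_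
  · rintro _ ⟨s, t, ht, rfl⟩
    exact h s t fun i => ht i (Set.mem_univ i)
  · simpa using h ∅ (fun _ => Set.univ) fun _ => MeasurableSet.univ

/-- An injection of a set into itself agrees on any finite subset with a finitely supported
permutation. -/
theorem exists_perm_eqOn {S : Type v} (f : S ↪ S) (A : Finset S) :
    ∃ g : Equiv.Perm S, {s | g s ≠ s}.Finite ∧ ∀ a ∈ A, g a = f a := by
  classical
  set B : Finset S := A ∪ A.map f
  let x : A ↪ B := ⟨fun a => ⟨a, Finset.mem_union_left _ a.2⟩, fun a b h =>
    Subtype.ext (congrArg (fun c : B => (c : S)) h)⟩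
  let y : A ↪ B := ⟨fun a => ⟨f a, Finset.mem_union_right _ (Finset.mem_map_of_mem f a.2)⟩,
    fun a b h => Subtype.ext (f.injective (congrArg (fun c : B => (c : S)) h))⟩
  have := Equiv.Perm.isMultiplyPretransitive B A.card
  obtain ⟨g, hg⟩ := MulAction.exists_smul_eq (Equiv.Perm B)
    (A.equivFin.symm.toEmbedding.trans x) (A.equivFin.symm.toEmbedding.trans y)
  refine ⟨Equiv.Perm.ofSubtype g, B.finite_toSet.subset fun s hs => ?_, fun a ha => ?_⟩
  · by_contra h
    exact hs (Equiv.Perm.ofSubtype_apply_of_not_mem g h)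
  · have h := DFunLike.congr_fun hg (A.equivFin ⟨a, ha⟩)
    have h' : g (x ⟨a, ha⟩) = y ⟨a, ha⟩ := by simpa using h
    rw [Equiv.Perm.ofSubtype_apply_of_mem g (Finset.mem_union_left _ ha)]
    exact congrArg Subtype.val h'

theorem measurable_relabel {V : Type v} {W : Type w} {K : Type u} [MeasurableSpace K] {k : ℕ}
    (f : V ↪ W) :
    Measurable (relabel f : (Set.powersetCard W k → K) → Set.powersetCard V k → K) := by
  unfold relabel
  fun_prop

/-- An exchangeable law is invariant under all injections of the vertex set into itself. -/
theorem IsExchangeable.map_relabel_embedding {S : Type v} {K : Type u} [MeasurableSpace K] {k : ℕ}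
    {μ : Measure (Set.powersetCard S k → K)} (hμ : IsExchangeable μ) (f : S ↪ S) :
    μ.map (relabel f) = μ := by
  classical
  have := hμ.isProbabilityMeasure
  refine measure_ext_of_boxes fun s t ht => ?_
  obtain ⟨g, hg, hgf⟩ := exists_perm_eqOn f (s.biUnion Subtype.val)
  have hbox : MeasurableSet (Set.pi (s : Set (Set.powersetCard S k)) t) :=
    .pi s.countable_toSet fun i _ => ht i
  conv_rhs => rw [← hμ.map_relabel g hg]
  rw [Measure.map_apply (measurable_relabel _) hbox, Measure.map_apply (measurable_relabel _) hbox]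
  congr 1
  ext ω
  simp only [Set.mem_preimage, Set.mem_pi, relabel]
  refine forall₂_congr fun e he => ?_
  have : Set.powersetCard.map k f e = Set.powersetCard.map k g.toEmbedding e := by
    refine Subtype.ext ?_
    simp only [Set.powersetCard.val_map, Finset.map_eq_image]
    refine Finset.image_congr fun a ha => (hgf a ?_).symm
    exact Finset.mem_biUnion.2 ⟨e, he, ha⟩
  rw [this]

section CondIndep

variable {Ω : Type u} {m m' m₀ : MeasurableSpace Ω} {ν : Measure Ω} [IsProbabilityMeasure ν]

/-- If `F` is a measure-preserving map that carries the σ-algebra `m` back into a smaller σ-algebra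
`m'`, then for an `F`-invariant event conditioning on `m` is the same as conditioning on `m'`. -/
theorem condExp_eq_of_preimage_eq (hm : m ≤ m₀) (hm' : m' ≤ m)
    {F : Ω → Ω} (hF : MeasurePreserving F ν ν) (hF' : Measurable[m', m] F) {D : Set Ω}
    (hD : MeasurableSet D) (hFD : F ⁻¹' D = D) :
    ν[D.indicator (fun _ => (1 : ℝ)) | m] =ᵐ[ν] ν[D.indicator (fun _ => (1 : ℝ)) | m'] := by
  set φ : Ω → ℝ := D.indicator fun _ => (1 : ℝ) with hφ
  set u := ν[φ | m]
  have hφF : φ ∘ F = φ := by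
    ext x
    have := Set.indicator_comp_right (s := D) F (g := fun _ => (1 : ℝ)) (x := x)
    rw [hFD] at this
    exact this.symm
  have hφm : Measurable φ := measurable_const.indicator hD
  have hφi : Integrable φ ν := (integrable_const 1).indicator hD
  have hφb : ∀ x, |φ x| ≤ 1 := fun x => by
    by_cases h : x ∈ D <;> simp [hφ, h]
  have hum : StronglyMeasurable[m] u := stronglyMeasurable_condExp
  have hub : ∀ᵐ x ∂ν, |u x| ≤ 1 := ae_bdd_abs_condExp_of_ae_bdd_abs (.of_forall hφb)
  have hwb : ∀ᵐ x ∂ν, |u (F x)| ≤ 1 := hF.quasiMeasurePreserving.ae hub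
  have hwm' : StronglyMeasurable[m'] (u ∘ F) := hum.comp_measurable hF'
  have hwm : StronglyMeasurable[m] (u ∘ F) := hwm'.mono hm'
  have hu0 := (hum.mono hm).aestronglyMeasurable (μ := ν)
  have hw0 := (hwm.mono hm).aestronglyMeasurable (μ := ν)
  have hint : ∀ {f g : Ω → ℝ}, AEStronglyMeasurable f ν → AEStronglyMeasurable g ν →
      (∀ᵐ x ∂ν, |f x| ≤ 1) → (∀ᵐ x ∂ν, |g x| ≤ 1) → Integrable (f * g) ν := by
    intro f g hf hg hfb hgb
    refine (integrable_const (1 : ℝ)).mono' (hf.mul hg) ?_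
    filter_upwards [hfb, hgb] with x h1 h2
    rw [Pi.mul_apply, Real.norm_eq_abs, abs_mul]
    exact mul_le_one₀ h1 (abs_nonneg _) h2
  have pull_out : ∀ {f : Ω → ℝ}, StronglyMeasurable[m] f → (∀ᵐ x ∂ν, |f x| ≤ 1) →
      ∫ x, (f * u) x ∂ν = ∫ x, (f * φ) x ∂ν := by
    intro f hf hfb
    have hfi := hint (hf.mono hm).aestronglyMeasurable hφm.aestronglyMeasurable hfb
      (.of_forall hφb)
    rw [← integral_condExp hm (f := f * φ)]
    exact integral_congr_ae (condExp_mul_of_stronglyMeasurable_left hf hfi hφi).symm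
  have comp : ∀ {f : Ω → ℝ}, AEStronglyMeasurable f ν → ∫ x, f (F x) ∂ν = ∫ x, f x ∂ν := by
    intro f hf
    conv_rhs => rw [← hF.map_eq]
    exact (integral_map hF.measurable.aemeasurable (by rwa [hF.map_eq])).symm
  have huu : Integrable (u * u) ν := hint hu0 hu0 hub hub
  have hwu : Integrable ((u ∘ F) * u) ν := hint hw0 hu0 hwb hub
  have hww : Integrable ((u ∘ F) * (u ∘ F)) ν := hint hw0 hw0 hwb hwb
  have e1 : ∫ x, ((u ∘ F) * (u ∘ F)) x ∂ν = ∫ x, (u * u) x ∂ν :=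
    comp (f := u * u) huu.aestronglyMeasurable
  have e2 : ∫ x, ((u ∘ F) * u) x ∂ν = ∫ x, (u * u) x ∂ν := by
    rw [pull_out hwm hwb, pull_out hum hub]
    rw [← comp (f := u * φ) (hu0.mul hφm.aestronglyMeasurable)]
    conv_lhs => rw [← hφF]
    rfl
  have hexp : (fun x => (u - u ∘ F) x ^ 2) =
      u * u - (2 : ℝ) • ((u ∘ F) * u) + (u ∘ F) * (u ∘ F) := by
    ext x
    simp only [Pi.sub_apply, Pi.mul_apply, Pi.add_apply, Pi.smul_apply, smul_eq_mul]
    ring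
  have hi : Integrable (fun x => (u - u ∘ F) x ^ 2) ν := by
    rw [hexp]
    exact (huu.sub (hwu.smul (2 : ℝ))).add hww
  have hsq : ∫ x, (u - u ∘ F) x ^ 2 ∂ν = 0 := by
    rw [hexp, integral_add' (huu.sub (hwu.smul (2 : ℝ))) hww,
      integral_sub' huu (hwu.smul (2 : ℝ))]
    simp only [Pi.smul_apply, smul_eq_mul]
    rw [integral_const_mul, e1, e2]
    ring
  have huw : u =ᵐ[ν] u ∘ F := by
    filter_upwards [(integral_eq_zero_iff_of_nonneg (fun x => sq_nonneg _) hi).1 hsq] with x hx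
    have : (u - u ∘ F) x = 0 := by simpa using hx
    exact sub_eq_zero.1 this
  have hwi : Integrable (u ∘ F) ν :=
    (integrable_condExp (m := m) (f := φ)).congr huw
  calc u =ᵐ[ν] u ∘ F := huw
    _ = ν[u ∘ F | m'] := (condExp_of_stronglyMeasurable (hm'.trans hm) hwm' hwi).symm
    _ =ᵐ[ν] ν[u | m'] := condExp_congr_ae huw.symm
    _ =ᵐ[ν] ν[φ | m'] := condExp_condExp_of_le hm' hm

end CondIndep

/-- A criterion for conditional independence of an array `z` from a σ-algebra `m` given `W`: any
finite part of `z` is left fixed by a measure-preserving map that carries `m` back into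
the σ-algebra generated by `W`. -/
theorem lintegral_eq_of_condIndep {Ω : Type u} {ι : Type v} {E K : Type w}
    {m m₀ : MeasurableSpace Ω} {ν : Measure Ω} [IsProbabilityMeasure ν] [Countable ι]
    [MeasurableSpace E] [MeasurableSpace K] [StandardBorelSpace K] [Nonempty K]
    {W : Ω → E} {z : Ω → ι → K} (hm : m ≤ m₀) (hW : Measurable[m] W) (hz : Measurable z)
    {P : Kernel E (ι → K)} [IsMarkovKernel P]
    (hP : ν.map (fun x => (W x, z x)) = ν.map W ⊗ₘ P)
    (hF : ∀ s : Finset ι, ∃ F : Ω → Ω, MeasurePreserving F ν ν ∧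
      Measurable[MeasurableSpace.comap W inferInstance, m] F ∧ ∀ x, ∀ i ∈ s, z (F x) i = z x i)
    {h : Ω → ENNReal} (hh : Measurable[m] h) {t : Set (ι → K)} (ht : MeasurableSet t) :
    ∫⁻ x, h x * (z ⁻¹' t).indicator (fun _ => (1 : ENNReal)) x ∂ν = ∫⁻ x, h x * P (W x) t ∂ν := by
  have hW₀ : Measurable[m₀] W := hW.mono hm le_rfl
  have hcomap : MeasurableSpace.comap W inferInstance ≤ m := hW.comap_le
  have key : ∀ B, MeasurableSet[m] B → ν (z ⁻¹' t ∩ B) = ∫⁻ x in B, P (W x) t ∂ν := by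
    intro B hB
    have hB₀ : MeasurableSet[m₀] B := hm _ hB
    suffices hmeas : (ν.restrict B).map z = (P.comap W hW₀) ∘ₘ (ν.restrict B) by
      have := congrArg (fun ρ : Measure (ι → K) => ρ t) hmeas
      rw [← Measure.restrict_apply (hz ht), ← Measure.map_apply hz ht]
      refine this.trans ?_
      simp only [Measure.bind_apply ht (Kernel.aemeasurable _), Kernel.comap_apply]
    refine measure_ext_of_boxes fun s b hb => ?_
    have hbox : MeasurableSet (Set.pi (s : Set ι) b) := .pi s.countable_toSet fun i _ => hb i
    rw [Measure.map_apply hz hbox, Measure.restrict_apply (hz hbox),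
      Measure.bind_apply hbox (Kernel.aemeasurable _)]
    simp only [Kernel.comap_apply]
    obtain ⟨F, hFν, hFm, hFz⟩ := hF s
    set D := z ⁻¹' Set.pi (s : Set ι) b with hD_def
    have hD : MeasurableSet D := hz hbox
    have hFD : F ⁻¹' D = D := by
      ext x
      simp only [hD_def, Set.mem_preimage, Set.mem_pi]
      exact forall₂_congr fun i hi => by rw [hFz x i hi]
    have e1 := condExp_eq_of_preimage_eq hm hcomap hFν hFm hD hFD
    have e2 := condDistrib_ae_eq_condExp (μ := ν) hW₀ hz hbox
    have e3 := ae_of_ae_map hW₀.aemeasurable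
      (condDistrib_ae_eq_of_measure_eq_compProd W hz.aemeasurable hP)
    have e4 : (fun x => (P (W x)).real (Set.pi (s : Set ι) b)) =ᵐ[ν]
        ν[D.indicator (fun _ => (1 : ℝ)) | m] := by
      filter_upwards [e1, e2, e3] with x h1 h2 h3
      rw [h1, ← h2, h3]
    have e5 : ∫ x in B, (P (W x)).real (Set.pi (s : Set ι) b) ∂ν = ν.real (D ∩ B) := by
      rw [integral_congr_ae (ae_restrict_of_ae e4),
        setIntegral_condExp hm ((integrable_const 1).indicator hD) hB,
        integral_indicator_const _ hD, measureReal_restrict_apply hD]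
      simp
    have hPm : Measurable fun x => P (W x) (Set.pi (s : Set ι) b) :=
      (P.measurable_coe hbox).comp hW₀
    rw [← ofReal_measureReal, ← e5]
    simp only [Measure.real]
    rw [integral_toReal hPm.aemeasurable (.of_forall fun x => measure_lt_top _ _),
      ENNReal.ofReal_toReal]
    refine ne_top_of_le_ne_top ENNReal.one_ne_top ?_
    refine (lintegral_mono (g := fun _ => 1) fun x => prob_le_one).trans ?_
    simpa using prob_le_one
  have hPm : Measurable fun x => P (W x) t := (P.measurable_coe ht).comp hW₀
  have htrim : (ν.restrict (z ⁻¹' t)).trim hm = (ν.withDensity fun x => P (W x) t).trim hm := by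
    refine @Measure.ext _ m _ _ fun B hB => ?_
    rw [trim_measurableSet_eq hm hB, trim_measurableSet_eq hm hB,
      withDensity_apply _ (hm _ hB), Measure.restrict_apply (hm _ hB), Set.inter_comm, key B hB]
  have hh₀ : Measurable[m₀] h := hh.mono hm le_rfl
  have := lintegral_trim hm hh (μ := ν.restrict (z ⁻¹' t))
  rw [htrim, lintegral_trim hm hh, lintegral_withDensity_eq_lintegral_mul _ hPm hh₀,
    ← lintegral_indicator (hz ht)] at this
  convert this.symm using 1
  · refine lintegral_congr fun x => ?_
    by_cases hx : x ∈ z ⁻¹' t <;> simp [hx]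
  · exact lintegral_congr fun x => mul_comm _ _

section Average

variable {Γ : Type v} [Fintype Γ] {X : Type u} {Y : Type w} [MeasurableSpace X] [MeasurableSpace Y]

/-- The average of a finite family of kernels. -/
noncomputable def averageKernel (Q : Γ → Kernel X Y) : Kernel X Y where
  toFun x := (Fintype.card Γ : ENNReal)⁻¹ • ∑ γ, Q γ x
  measurable' := by
    refine Measure.measurable_of_measurable_coe _ fun s hs => ?_
    simp only [Measure.smul_apply, Measure.finsetSum_apply, smul_eq_mul]
    exact (Finset.measurable_sum _ fun γ _ => (Q γ).measurable_coe hs).const_mul _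

theorem averageKernel_apply (Q : Γ → Kernel X Y) (x : X) (s : Set Y) :
    averageKernel Q x s = (Fintype.card Γ : ENNReal)⁻¹ * ∑ γ, Q γ x s := by
  change ((Fintype.card Γ : ENNReal)⁻¹ • ∑ γ, Q γ x) s = _
  simp only [Measure.smul_apply, Measure.finsetSum_apply, smul_eq_mul]

theorem card_inv_mul_sum_const [Nonempty Γ] (c : ENNReal) :
    (Fintype.card Γ : ENNReal)⁻¹ * ∑ _γ : Γ, c = c := by
  rw [Finset.sum_const, Finset.card_univ, nsmul_eq_mul, ← mul_assoc,
    ENNReal.inv_mul_cancel (by simp) (by simp), one_mul]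

instance [Nonempty Γ] (Q : Γ → Kernel X Y) [∀ γ, IsMarkovKernel (Q γ)] :
    IsMarkovKernel (averageKernel Q) :=
  ⟨fun x => ⟨by simp only [averageKernel_apply, measure_univ, card_inv_mul_sum_const]⟩⟩

theorem compProd_averageKernel [Nonempty Γ] {ρ : Measure X} [IsProbabilityMeasure ρ]
    {θ : Measure (X × Y)} (Q : Γ → Kernel X Y) [∀ γ, IsMarkovKernel (Q γ)]
    (h : ∀ γ, ρ ⊗ₘ Q γ = θ) : ρ ⊗ₘ averageKernel Q = θ := by
  refine Measure.ext_prod_iff.2 fun {A B} hA hB => ?_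
  rw [Measure.compProd_apply_prod hA hB]
  simp only [averageKernel_apply]
  rw [lintegral_const_mul _ (Finset.measurable_sum _ fun γ _ => (Q γ).measurable_coe hB),
    lintegral_finsetSum _ fun γ _ => (Q γ).measurable_coe hB]
  simp only [← Measure.compProd_apply_prod hA hB, h, card_inv_mul_sum_const]

end Average

namespace Lower

variable {Z : ℕ → Type u} {n : ℕ} {V : Type v} {W : Type w} {U : Type*}

theorem pull_pull (f : V ↪ W) (g : W ↪ U) (z : Lower Z n U) :
    pull f (pull g z) = pull (f.trans g) z := by
  funext j a
  change z j _ = z j _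
  congr 1
  exact Subtype.ext (Finset.map_map _ _ _)

theorem pull_refl (z : Lower Z n V) : pull (Function.Embedding.refl V) z = z := by
  funext j a
  change z j _ = z j _
  congr 1
  exact Subtype.ext Finset.map_refl

/-- Symmetrisation: if the joint law of `(W, z)` is invariant under the action of `Sym([n])` on `W`,
then `z` has a symmetric conditional distribution given `W`. -/
theorem exists_isSymmetric_condDistrib [∀ i, MeasurableSpace (Z i)] {Ω : Type v} {Y : Type w}
    [MeasurableSpace Ω] [MeasurableSpace Y] [StandardBorelSpace Y] [Nonempty Y] {ν : Measure Ω}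
    [IsProbabilityMeasure ν] {W : Ω → Lower Z n (Fin n)} {z : Ω → Y} (hW : Measurable W)
    (hz : Measurable z)
    (hinv : ∀ σ : Equiv.Perm (Fin n), ν.map (fun x => (pull σ.toEmbedding (W x), z x)) =
      ν.map fun x => (W x, z x)) :
    ∃ P : Kernel (Lower Z n (Fin n)) Y, IsMarkovKernel P ∧ IsSymmetric P ∧
      ν.map W ⊗ₘ P = ν.map fun x => (W x, z x) := by
  have := Measure.isProbabilityMeasure_map hW.aemeasurable (μ := ν)
  set Q := condDistrib z W ν with hQ
  have hσ (σ : Equiv.Perm (Fin n)) : Measurable (pull σ.toEmbedding :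
    Lower Z n (Fin n) → Lower Z n (Fin n)) := measurable_pull _
  refine ⟨averageKernel fun σ : Equiv.Perm (Fin n) => Q.comap (pull σ.toEmbedding) (hσ σ),
    inferInstance, fun τ x => ?_, compProd_averageKernel _ fun σ => ?_⟩
  · refine Measure.ext fun s _ => ?_
    simp only [averageKernel_apply, Kernel.comap_apply, pull_pull]
    congr 1
    refine Fintype.sum_equiv (Equiv.mulLeft τ) _ _ fun σ => ?_
    rfl
  · refine Measure.ext_prod_iff.2 fun {A B} hA hB => ?_
    set A' : Set (Lower Z n (Fin n)) := pull σ.symm.toEmbedding ⁻¹' A with hA'_def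
    have hA' : MeasurableSet A' := hσ σ.symm hA
    have hAA' : A = pull σ.toEmbedding ⁻¹' A' := by
      ext x
      have : σ.symm.toEmbedding.trans σ.toEmbedding = Function.Embedding.refl _ := by
        ext
        simp
      simp only [hA'_def, Set.mem_preimage, pull_pull, this, pull_refl]
    have hlaw : (ν.map W).map (pull σ.toEmbedding) = ν.map W := by
      have := congrArg Measure.fst (hinv σ)
      rw [Measure.fst_map_prodMk hz, Measure.fst_map_prodMk hz] at this
      rw [Measure.map_map (hσ σ) hW]
      exact this
    rw [Measure.compProd_apply_prod hA hB]
    simp only [Kernel.comap_apply]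
    rw [hAA', ← setLIntegral_map hA' (Q.measurable_coe hB) (hσ σ), hlaw,
      ← Measure.compProd_apply_prod hA' hB, hQ, compProd_map_condDistrib hz.aemeasurable]
    have hσW : Measurable fun x => (pull σ.toEmbedding (W x), z x) := ((hσ σ).comp hW).prodMk hz
    refine (congrArg (fun θ : Measure _ => θ (A' ×ˢ B)) (hinv σ).symm).trans ?_
    rw [Measure.map_apply hσW (hA'.prod hB),
      Measure.map_apply (hW.prodMk hz) (((hσ σ) hA').prod hB)]
    rfl

end Lower

instance {Z : ℕ → Type u} [∀ i, MeasurableSpace (Z i)] {i : ℕ} {Y : Type w} [MeasurableSpace Y]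
    (S : Type v) (P : Kernel (Lower Z i (Fin i)) Y) [IsMarkovKernel P] :
    IsMarkovKernel (edgeKernel S P) := by
  unfold edgeKernel
  infer_instance

section Array

variable {S : Type v} {K : Type u}

/-- The action of an injection `f : T ↪ T` on colourings of all finite subsets of `T`. -/
def reindex {T : Type v} (f : T ↪ T) (x : Finset T → K) : Finset T → K := fun d => x (d.map f)

/-- The part of a colouring `x` of the finite subsets of `S ⊕ ℕ` that consists of the colours of the
sets whose intersection with `S` is `a`. -/
def colour (a : Finset S) (x : Finset (S ⊕ ℕ) → K) : Finset ℕ → K := fun c => x (a.disjSum c)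

/-- The parts `colour a x` for all `a` of size `< n`. -/
def lowerColours (n : ℕ) (x : Finset (S ⊕ ℕ) → K) : Lower (fun _ => Finset ℕ → K) n S :=
  fun _ a => colour a x

theorem colour_map (g : S ↪ S) (a : Finset S) (x : Finset (S ⊕ ℕ) → K) :
    colour (a.map g) x = colour a (reindex (g.sumMap (Function.Embedding.refl ℕ)) x) := by
  funext c
  simp only [colour, reindex]
  congr 1
  ext y
  cases y <;> simp

theorem snoc_lowerColours (n : ℕ) (x : Finset (S ⊕ ℕ) → K) :
    Lower.snoc (lowerColours n x, fun e : Set.powersetCard S n => colour (e : Finset S) x) =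
      lowerColours (n + 1) x := by
  funext j
  refine Fin.lastCases ?_ (fun i => ?_) j
  · simp only [Lower.snoc, Fin.snoc_last]
    rfl
  · simp only [Lower.snoc, Fin.snoc_castSucc]
    rfl

theorem pull_lowerColours_reindex (n : ℕ) (ι : Fin n ↪ S) (g : Equiv.Perm S)
    (x : Finset (S ⊕ ℕ) → K) :
    (Lower.pull ι
        (lowerColours n (reindex (g.toEmbedding.sumMap (Function.Embedding.refl ℕ)) x)),
      colour (Finset.univ.map ι)
        (reindex (g.toEmbedding.sumMap (Function.Embedding.refl ℕ)) x)) =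
      (Lower.pull (ι.trans g.toEmbedding) (lowerColours n x),
        colour (Finset.univ.map (ι.trans g.toEmbedding)) x) := by
  refine Prod.ext ?_ ?_
  · funext j a
    exact (colour_map _ _ _).symm.trans (congrArg (colour · x) (Finset.map_map _ _ _))
  · exact (colour_map _ _ _).symm.trans (congrArg (colour · x) (Finset.map_map _ _ _))

variable [MeasurableSpace K]

theorem measurable_reindex {T : Type v} (f : T ↪ T) :
    Measurable (reindex f : (Finset T → K) → Finset T → K) := by
  unfold reindex
  fun_prop

theorem measurable_colour (a : Finset S) :
    Measurable (colour a : (Finset (S ⊕ ℕ) → K) → Finset ℕ → K) := by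
  unfold colour
  fun_prop

theorem measurable_lowerColours (n : ℕ) :
    Measurable (lowerColours n : (Finset (S ⊕ ℕ) → K) → Lower (fun _ => Finset ℕ → K) n S) := by
  unfold lowerColours colour
  fun_prop

/-- The σ-algebra generated by the colours of all sets that do not contain `e`. -/
abbrev awayFrom (K : Type u) [MeasurableSpace K] (e : Finset S) :
    MeasurableSpace (Finset (S ⊕ ℕ) → K) :=
  MeasurableSpace.comap
    (fun x (d : {d : Finset (S ⊕ ℕ) // ¬ e ⊆ d.toLeft}) => x d) inferInstance

theorem awayFrom_le (e : Finset S) : awayFrom K e ≤ MeasurableSpace.pi :=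
  Measurable.comap_le (by fun_prop)

theorem measurable_to_awayFrom {Ω : Type w} {m : MeasurableSpace Ω} {e : Finset S}
    {F : Ω → Finset (S ⊕ ℕ) → K}
    (h : ∀ d : Finset (S ⊕ ℕ), ¬ e ⊆ d.toLeft → Measurable fun x => F x d) :
    Measurable[m, awayFrom K e] F :=
  measurable_comap_iff.2 (measurable_pi_iff.2 fun d => h d d.2)

theorem measurable_awayFrom_colour {e a : Finset S} (h : ¬ e ⊆ a) :
    Measurable[awayFrom K e] (colour a : (Finset (S ⊕ ℕ) → K) → Finset ℕ → K) := by
  refine @measurable_pi_lambda _ _ _ (awayFrom K e) _ _ fun c => ?_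
  have hd : ¬ e ⊆ (a.disjSum c).toLeft := by rwa [Finset.toLeft_disjSum]
  exact (measurable_pi_apply (X := fun _ : {d : Finset (S ⊕ ℕ) // ¬ e ⊆ d.toLeft} => K)
    ⟨_, hd⟩).comp (comap_measurable _)

theorem measurable_awayFrom_lowerColours {n : ℕ} (e : Set.powersetCard S n) :
    Measurable[awayFrom K (e : Finset S)]
      (lowerColours n : (Finset (S ⊕ ℕ) → K) → Lower (fun _ => Finset ℕ → K) n S) := by
  refine @measurable_pi_lambda _ _ _ (awayFrom K (e : Finset S)) _ _ fun j => ?_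
  refine @measurable_pi_lambda _ _ _ (awayFrom K (e : Finset S)) _ _ fun a => ?_
  refine measurable_awayFrom_colour fun h => ?_
  have := Finset.card_le_card h
  rw [Set.powersetCard.card_eq, Set.powersetCard.card_eq] at this
  omega

/-- There is an injection of `S ⊕ ℕ` into itself that fixes all points of `e ⊕ [N]` and maps all
other points into `ℕ`. -/
theorem exists_embedding_into_nat [Countable S] (e : Finset S) (N : ℕ) :
    ∃ f : S ⊕ ℕ ↪ S ⊕ ℕ, (∀ a ∈ e, f (.inl a) = .inl a) ∧ (∀ i < N, f (.inr i) = .inr i) ∧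
      ∀ y b, f y = .inl b → b ∈ e := by
  classical
  obtain ⟨c, hc⟩ := exists_injective_nat (S ⊕ ℕ)
  let fixed : S ⊕ ℕ → Prop := Sum.elim (· ∈ e) (· < N)
  have hfixed : ∀ y i, y = .inr i → fixed y → i < N := by
    rintro _ i rfl h
    exact h
  refine ⟨⟨fun y => if fixed y then y else .inr (N + c y), fun y y' h => ?_⟩,
    fun a ha => if_pos ha, fun i hi => if_pos hi, fun y b h => ?_⟩
  · by_cases h1 : fixed y <;> by_cases h2 : fixed y' <;> simp only [h1, h2, if_true, if_false] at h
    · exact h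
    · have := hfixed _ _ h h1
      omega
    · have := hfixed _ _ h.symm h2
      omega
    · simp only [Sum.inr.injEq, Nat.add_left_cancel_iff] at h
      exact hc h
  · change (if fixed y then y else .inr (N + c y)) = _ at h
    split_ifs at h with h1
    subst h
    exact h1

variable {ν : Measure (Finset (S ⊕ ℕ) → K)}

/-- In an array invariant under injections, the part `colour e` is conditionally independent of the
colours of all sets that do not contain `e`, given the parts `colour a` for `a ⊊ e`. -/
theorem lintegral_colour_eq [IsProbabilityMeasure ν] [Countable S] [StandardBorelSpace K] [Nonempty K]
    (hν : ∀ f : S ⊕ ℕ ↪ S ⊕ ℕ, ν.map (reindex f) = ν) {n : ℕ} (e : Set.powersetCard S n)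
    {P : Kernel (Lower (fun _ => Finset ℕ → K) n (Fin n)) (Finset ℕ → K)} [IsMarkovKernel P]
    (hP : ν.map (fun x => (Lower.pull (enum e) (lowerColours n x), colour (e : Finset S) x)) =
      ν.map (fun x => Lower.pull (enum e) (lowerColours n x)) ⊗ₘ P)
    {h : (Finset (S ⊕ ℕ) → K) → ENNReal} (hh : Measurable[awayFrom K (e : Finset S)] h)
    {t : Set (Finset ℕ → K)} (ht : MeasurableSet t) :
    ∫⁻ x, h x * (colour (e : Finset S) ⁻¹' t).indicator (fun _ => (1 : ENNReal)) x ∂ν =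
      ∫⁻ x, h x * P (Lower.pull (enum e) (lowerColours n x)) t ∂ν := by
  classical
  have hW : Measurable[awayFrom K (e : Finset S)] fun x : Finset (S ⊕ ℕ) → K =>
      Lower.pull (enum e) (lowerColours n x) :=
    (Lower.measurable_pull _).comp (measurable_awayFrom_lowerColours e)
  refine lintegral_eq_of_condIndep (awayFrom_le _) hW (measurable_colour _) hP (fun s => ?_) hh ht
  obtain ⟨f, hfe, hfN, hf⟩ := exists_embedding_into_nat (e : Finset S) ((s.sup id).sup id + 1)
  refine ⟨reindex f, ⟨measurable_reindex f, hν f⟩, measurable_to_awayFrom fun d hd => ?_,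
    fun x c hc => ?_⟩
  · set a := (d.map f).toLeft with ha
    have hae : a ⊆ (e : Finset S) := fun b hb => by
      obtain ⟨y, -, hy⟩ := Finset.mem_map.1 (Finset.mem_toLeft.1 hb)
      exact hf y b hy
    have hea : ¬ (e : Finset S) ⊆ a := fun h => hd fun b hb => by
      obtain ⟨y, hyd, hy⟩ := Finset.mem_map.1 (Finset.mem_toLeft.1 (h hb))
      rw [← hfe b hb] at hy
      rwa [Finset.mem_toLeft, ← f.injective hy]
    have hrange : (e : Finset S) = Finset.univ.map (enum e) := by
      conv_lhs => rw [← ofFinEmb_enum e]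
      exact Set.powersetCard.val_ofFinEmb _ _ _
    obtain ⟨b, -, hb⟩ := Finset.subset_map_iff.1 (hrange ▸ hae)
    have hbn : b.card < n := by
      have := Finset.card_lt_card (Finset.ssubset_iff_subset_ne.2 ⟨hae, fun h => hea h.ge⟩)
      rwa [hb, Finset.card_map, Set.powersetCard.card_eq] at this
    have hx : (fun x : Finset (S ⊕ ℕ) → K => reindex f x d) = (fun l => l (d.map f).toRight) ∘
        (fun l : Lower (fun _ => Finset ℕ → K) n (Fin n) => l ⟨b.card, hbn⟩ ⟨b, rfl⟩) ∘
        fun x => Lower.pull (enum e) (lowerColours n x) := by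
      funext x
      change x (d.map f) = x ((b.map (enum e)).disjSum (d.map f).toRight)
      rw [← hb, ha, Finset.toLeft_disjSum_toRight]
    rw [hx]
    exact (measurable_pi_apply _).comp
      (((measurable_pi_apply _).comp (measurable_pi_apply _)).comp (comap_measurable _))
  · have hcN : ∀ i ∈ c, i < (s.sup id).sup id + 1 := fun i hi =>
      Nat.lt_succ_of_le (Finset.le_sup (f := id) (Finset.mem_sup.2 ⟨c, hc, hi⟩))
    change x _ = x _
    congr 1
    rw [Finset.map_eq_image]
    conv_rhs => rw [← Finset.image_id (s := (e : Finset S).disjSum c)]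
    refine Finset.image_congr fun y hy => ?_
    rcases Finset.mem_disjSum.1 hy with ⟨a, ha, rfl⟩ | ⟨i, hi, rfl⟩
    · exact hfe a ha
    · exact hfN i (hcN i hi)

/-- The joint law of `colour (range ι)` and the `colour a` for `a ⊊ range ι` does not depend on the
injection `ι : [n] → S`. -/
theorem map_pull_lowerColours_eq (hν : ∀ f : S ⊕ ℕ ↪ S ⊕ ℕ, ν.map (reindex f) = ν) {n : ℕ}
    (ι ι' : Fin n ↪ S) :
    ν.map (fun x => (Lower.pull ι (lowerColours n x), colour (Finset.univ.map ι) x)) =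
      ν.map (fun x => (Lower.pull ι' (lowerColours n x), colour (Finset.univ.map ι') x)) := by
  have hW (ι : Fin n ↪ S) : Measurable fun x : Finset (S ⊕ ℕ) → K =>
      Lower.pull ι (lowerColours n x) :=
    (Lower.measurable_pull _).comp (measurable_lowerColours n)
  have hmeas (ι : Fin n ↪ S) := (hW ι).prodMk (measurable_colour (K := K) (Finset.univ.map ι))
  have key (g : Equiv.Perm S) :
      ν.map (fun x => (Lower.pull ι (lowerColours n x), colour (Finset.univ.map ι) x)) =
      ν.map (fun x => (Lower.pull (ι.trans g.toEmbedding) (lowerColours n x),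
        colour (Finset.univ.map (ι.trans g.toEmbedding)) x)) := by
    conv_lhs => rw [← hν (g.toEmbedding.sumMap (Function.Embedding.refl ℕ))]
    rw [Measure.map_map (hmeas ι) (measurable_reindex _)]
    exact congrArg (fun F => ν.map F) (funext (pull_lowerColours_reindex n ι g))
  have hι : ∃ g : Equiv.Perm S, ι.trans g.toEmbedding = ι' := by
    have := Equiv.Perm.isMultiplyPretransitive S n
    exact MulAction.exists_smul_eq (Equiv.Perm S) ι ι'
  obtain ⟨g, hg⟩ := hι
  rw [key g, hg]

theorem exists_isSymmetric_kernel [IsProbabilityMeasure ν] [Infinite S]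
    [StandardBorelSpace K] [Nonempty K]
    (hν : ∀ f : S ⊕ ℕ ↪ S ⊕ ℕ, ν.map (reindex f) = ν) (n : ℕ) :
    ∃ P : Kernel (Lower (fun _ => Finset ℕ → K) n (Fin n)) (Finset ℕ → K),
      IsMarkovKernel P ∧ IsSymmetric P ∧ ∀ ι : Fin n ↪ S,
        ν.map (fun x => (Lower.pull ι (lowerColours n x), colour (Finset.univ.map ι) x)) =
          ν.map (fun x => Lower.pull ι (lowerColours n x)) ⊗ₘ P := by
  have hW (ι : Fin n ↪ S) : Measurable fun x : Finset (S ⊕ ℕ) → K =>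
      Lower.pull ι (lowerColours n x) :=
    (Lower.measurable_pull _).comp (measurable_lowerColours n)
  obtain ⟨ι₀⟩ : Nonempty (Fin n ↪ S) := ⟨Fin.valEmbedding.trans (Infinite.natEmbedding S)⟩
  obtain ⟨P, hP, hsymm, h⟩ := Lower.exists_isSymmetric_condDistrib (ν := ν) (hW ι₀)
    (measurable_colour (Finset.univ.map ι₀)) fun σ => by
      have hσ := map_pull_lowerColours_eq hν (σ.toEmbedding.trans ι₀) ι₀
      rw [← Finset.map_map, Finset.map_univ_equiv] at hσ
      simpa only [Lower.pull_pull] using hσ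
  refine ⟨P, hP, hsymm, fun ι => ?_⟩
  have hlaw := map_pull_lowerColours_eq hν ι ι₀
  have hfst := congrArg Measure.fst hlaw
  rw [Measure.fst_map_prodMk (measurable_colour _), Measure.fst_map_prodMk (measurable_colour _)]
    at hfst
  rw [hlaw, hfst, h]

/-- The parts `colour e` for `e` of size `n` are conditionally independent given the parts of smaller
rank. -/
theorem map_lowerColours_prod [IsProbabilityMeasure ν] [Countable S]
    [StandardBorelSpace K] [Nonempty K]
    (hν : ∀ f : S ⊕ ℕ ↪ S ⊕ ℕ, ν.map (reindex f) = ν) {n : ℕ}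
    (P : Kernel (Lower (fun _ => Finset ℕ → K) n (Fin n)) (Finset ℕ → K)) [IsMarkovKernel P]
    (hP : ∀ ι : Fin n ↪ S,
      ν.map (fun x => (Lower.pull ι (lowerColours n x), colour (Finset.univ.map ι) x)) =
        ν.map (fun x => Lower.pull ι (lowerColours n x)) ⊗ₘ P) :
    ν.map (fun x => (lowerColours n x,
        fun e : Set.powersetCard S n => colour (e : Finset S) x)) =
      ν.map (lowerColours n) ⊗ₘ edgeKernel S P := by
  classical
  have hrange (e : Set.powersetCard S n) : Finset.univ.map (enum e) = (e : Finset S) := by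
    conv_rhs => rw [← ofFinEmb_enum e]
    exact (Set.powersetCard.val_ofFinEmb _ _ _).symm
  have hPe (e : Set.powersetCard S n) := hrange e ▸ hP (enum e)
  have hL := measurable_lowerColours (S := S) (K := K) n
  have hcol : Measurable fun (x : Finset (S ⊕ ℕ) → K) (e : Set.powersetCard S n) =>
    colour (e : Finset S) x := measurable_pi_lambda _ fun e => measurable_colour _
  have hprod : ∀ (t : Set.powersetCard S n → Set (Finset ℕ → K)), (∀ e, MeasurableSet (t e)) →
      ∀ (s : Finset (Set.powersetCard S n)) (h : (Finset (S ⊕ ℕ) → K) → ENNReal),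
      (∀ e : Set.powersetCard S n, Measurable[awayFrom K (e : Finset S)] h) →
      ∫⁻ x, h x * ∏ e ∈ s, (colour (e : Finset S) ⁻¹' t e).indicator (fun _ => (1 : ENNReal)) x ∂ν =
        ∫⁻ x, h x * ∏ e ∈ s, P (Lower.pull (enum e) (lowerColours n x)) (t e) ∂ν := by
    intro t ht s
    induction s using Finset.induction_on with
    | empty => simp
    | insert e s he ih =>
      intro h hh
      have hPm (e' : Set.powersetCard S n) : Measurable[awayFrom K (e' : Finset S)]
          fun x => P (Lower.pull (enum e) (lowerColours n x)) (t e) :=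
        (P.measurable_coe (ht e)).comp
          ((Lower.measurable_pull _).comp (measurable_awayFrom_lowerColours e'))
      have hs : Measurable[awayFrom K (e : Finset S)] fun x : Finset (S ⊕ ℕ) → K =>
          ∏ e' ∈ s, (colour (e' : Finset S) ⁻¹' t e').indicator (fun _ => (1 : ENNReal)) x := by
        refine @Finset.measurable_fun_prod _ _ _ _ _ _
          (awayFrom K (e : Finset S)) _ _ fun e' he' => ?_
        refine (@measurable_const _ _ _ (awayFrom K (e : Finset S)) _).indicator ?_
        refine measurable_awayFrom_colour (fun hsub => he ?_) (ht e')
        rwa [Set.powersetCard.eq_iff_subset.2 hsub]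
      have := lintegral_colour_eq hν e (hPe e) ((hh e).mul hs) (ht e)
      calc _ = _ := lintegral_congr fun x => ?_
        _ = _ := this
        _ = _ := lintegral_congr fun x => ?_
        _ = _ := ih (fun x => h x * P (Lower.pull (enum e) (lowerColours n x)) (t e))
          fun e' => (hh e').mul (hPm e')
        _ = _ := lintegral_congr fun x => ?_
      · rw [Finset.prod_insert he]
        simp only [Pi.mul_apply]
        ring
      · simp only [Pi.mul_apply]
        ring
      · rw [Finset.prod_insert he]
        ring
  have := Measure.isProbabilityMeasure_map hL.aemeasurable (μ := ν)
  have := Measure.isProbabilityMeasure_map (hL.prodMk hcol).aemeasurable (μ := ν)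
  refine Measure.ext_prod_iff.2 fun {A B} hA hB => ?_
  suffices h : ((ν.map fun x => (lowerColours n x, fun e : Set.powersetCard S n =>
      colour (e : Finset S) x)).restrict (Prod.fst ⁻¹' A)).map Prod.snd =
      ((ν.map (lowerColours n) ⊗ₘ edgeKernel S P).restrict (Prod.fst ⁻¹' A)).map Prod.snd by
    have hB' := congrArg (fun θ : Measure (Set.powersetCard S n → Finset ℕ → K) => θ B) h
    simp only [Measure.map_apply measurable_snd hB,
      Measure.restrict_apply (measurable_snd hB)] at hB'
    rwa [Set.inter_comm] at hB'
  refine measure_ext_of_boxes fun s t ht => ?_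
  have hbox : MeasurableSet (Set.pi (s : Set (Set.powersetCard S n)) t) :=
    .pi s.countable_toSet fun i _ => ht i
  have hA₁ := hL hA
  have hD := hA₁.inter (hcol hbox)
  rw [Measure.map_apply measurable_snd hbox, Measure.restrict_apply (measurable_snd hbox),
    Measure.map_apply measurable_snd hbox, Measure.restrict_apply (measurable_snd hbox),
    Set.inter_comm]
  have hrect : ((Prod.fst ⁻¹' A ∩ Prod.snd ⁻¹' Set.pi (s : Set (Set.powersetCard S n)) t) :
      Set (Lower (fun _ => Finset ℕ → K) n S × (Set.powersetCard S n → Finset ℕ → K))) =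
      A ×ˢ Set.pi (s : Set (Set.powersetCard S n)) t := rfl
  rw [hrect, Measure.map_apply (hL.prodMk hcol) (hA.prod hbox),
    Measure.compProd_apply_prod hA hbox, setLIntegral_map hA (Kernel.measurable_coe _ hbox) hL,
    ← lintegral_indicator hA₁, Set.mk_preimage_prod, ← lintegral_indicator_one hD]
  have hh (e : Set.powersetCard S n) : Measurable[awayFrom K (e : Finset S)]
      ((lowerColours n ⁻¹' A).indicator fun _ => (1 : ENNReal)) :=
    (@measurable_const _ _ _ (awayFrom K (e : Finset S)) _).indicator
      (measurable_awayFrom_lowerColours e hA)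
  refine Eq.trans (lintegral_congr fun x => ?_) ((hprod t ht s _ hh).trans
    (lintegral_congr fun x => ?_))
  · by_cases hx : x ∈ lowerColours n ⁻¹' A
    · by_cases hx' : ∀ e ∈ s, colour (e : Finset S) x ∈ t e
      · have hxD : x ∈ lowerColours n ⁻¹' A ∩ (fun x (e : Set.powersetCard S n) =>
            colour (e : Finset S) x) ⁻¹' Set.pi (s : Set (Set.powersetCard S n)) t := ⟨hx, hx'⟩
        rw [Set.indicator_of_mem hxD, Set.indicator_of_mem hx, one_mul,
          Finset.prod_eq_one fun e he => Set.indicator_of_mem (Set.mem_preimage.2 (hx' e he)) _]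
        rfl
      · rw [Set.indicator_of_notMem fun h => hx' h.2]
        push Not at hx'
        obtain ⟨e, he, hne⟩ := hx'
        rw [Finset.prod_eq_zero he (Set.indicator_of_notMem (mt Set.mem_preimage.1 hne) _), mul_zero]
    · rw [Set.indicator_of_notMem fun h => hx h.1, Set.indicator_of_notMem hx, zero_mul]
  · by_cases hx : x ∈ lowerColours n ⁻¹' A
    · rw [Set.indicator_of_mem hx, Set.indicator_of_mem hx, one_mul]
      exact (Measure.infinitePi_pi _ fun e _ => ht e).symm
    · rw [Set.indicator_of_notMem hx, Set.indicator_of_notMem hx, zero_mul]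

end Array

section Extend

variable {S : Type v} {T : Type w} {K : Type u} {k : ℕ}

open Classical in
/-- Transport a colouring of the `k`-subsets of `S` to the `k`-subsets of `T` and give all other
finite subsets of `T` the colour `c`. -/
noncomputable def extend (φ : T ↪ S) (c : K) (ω : Set.powersetCard S k → K) : Finset T → K :=
  fun d => if h : d.card = k then ω ⟨d.map φ, by simpa using h⟩ else c

theorem measurable_extend [MeasurableSpace K] (φ : T ↪ S) (c : K) :
    Measurable (extend φ c : (Set.powersetCard S k → K) → Finset T → K) := by
  refine measurable_pi_lambda _ fun d => ?_
  by_cases h : d.card = k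
  · simp only [extend, h, dite_true]
    fun_prop
  · simp only [extend, h, dite_false]
    fun_prop

theorem reindex_extend (φ : T ≃ S) (c : K) (f : T ↪ T) (ω : Set.powersetCard S k → K) :
    reindex f (extend φ.toEmbedding c ω) = extend φ.toEmbedding c
      (relabel (φ.symm.toEmbedding.trans (f.trans φ.toEmbedding)) ω) := by
  funext d
  by_cases h : d.card = k
  · simp only [reindex, extend, Finset.card_map, h, dite_true, relabel]
    congr 1
    refine Subtype.ext ?_
    simp only [Set.powersetCard.val_map, Finset.map_map]
    congr 1
    ext
    simp
  · simp only [reindex, extend, Finset.card_map, h, dite_false]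

theorem IsExchangeable.map_reindex_extend [MeasurableSpace K]
    {μ : Measure (Set.powersetCard S k → K)} (hμ : IsExchangeable μ) (φ : T ≃ S) (c : K)
    (f : T ↪ T) :
    (μ.map (extend φ.toEmbedding c)).map (reindex f) = μ.map (extend φ.toEmbedding c) := by
  rw [Measure.map_map (measurable_reindex f) (measurable_extend _ c)]
  conv_rhs => rw [← hμ.map_relabel_embedding
    (φ.symm.toEmbedding.trans (f.trans φ.toEmbedding)),
    Measure.map_map (measurable_extend _ c) (measurable_relabel _)]
  exact congrArg (fun F => μ.map F) (funext (reindex_extend φ c f))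

theorem colour_extend (φ : S ⊕ ℕ ↪ S) (c : K) (ω : Set.powersetCard S k → K) :
    (fun e : Set.powersetCard S k => colour (e : Finset S) (extend φ c ω) ∅) =
      relabel (Function.Embedding.inl.trans φ) ω := by
  funext e
  have h : ((e : Finset S).disjSum (∅ : Finset ℕ)).card = k := by simp
  simp only [colour, extend, h, dite_true, relabel]
  congr 1
  refine Subtype.ext ?_
  simp only [Set.powersetCard.val_map, Finset.disjSum_empty, Finset.map_map]

end Extend

theorem edgeKernel_map {Z : ℕ → Type u} [∀ i, MeasurableSpace (Z i)] {i : ℕ} {Y Y' : Type w}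
    [MeasurableSpace Y] [MeasurableSpace Y'] (S : Type v) (P : Kernel (Lower Z i (Fin i)) Y)
    [IsMarkovKernel P] {f : Y → Y'} (hf : Measurable f) [IsMarkovKernel (P.map f)] :
    edgeKernel S (P.map f) = (edgeKernel S P).map fun y e => f (y e) := by
  ext1 z
  rw [Kernel.map_apply _ (by fun_prop)]
  change Measure.infinitePi (fun e => (P.map f) (Lower.pull (enum e) z)) =
    (Measure.infinitePi fun e => P (Lower.pull (enum e) z)).map _
  rw [Measure.infinitePi_map_pi _ fun _ => hf]
  simp only [Kernel.map_apply _ hf]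

section Array

variable {S : Type v} {K : Type u} [MeasurableSpace K] {ν : Measure (Finset (S ⊕ ℕ) → K)}

theorem measurable_colours (n : ℕ) :
    Measurable fun (x : Finset (S ⊕ ℕ) → K) (e : Set.powersetCard S n) =>
      colour (e : Finset S) x :=
  measurable_pi_lambda _ fun _ => measurable_colour _

theorem map_lowerColours_one :
    (ν.map (colour ∅)).map (fun z => Lower.snoc (Z := fun _ => Finset ℕ → K) (V := S) (n := 0)
      (fun j => j.elim0, fun _ => z)) = ν.map (lowerColours 1) := by
  have hsnoc : Measurable fun z => Lower.snoc (Z := fun _ => Finset ℕ → K) (V := S) (n := 0)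
      (fun j => j.elim0, fun _ => z) :=
    Lower.measurable_snoc.comp (by fun_prop)
  rw [Measure.map_map hsnoc (measurable_colour _)]
  congr 1
  funext x
  rw [← snoc_lowerColours]
  refine congrArg Lower.snoc (Prod.ext (Subsingleton.elim _ _) (funext fun e => ?_))
  have : (e : Finset S) = ∅ := Finset.card_eq_zero.1 e.2
  simp only [this]

variable [StandardBorelSpace K] [IsProbabilityMeasure ν]
  (P : (n : ℕ) → Kernel (Lower (fun _ => Finset ℕ → K) n (Fin n)) (Finset ℕ → K))
  [∀ n, IsMarkovKernel (P n)] (hsymm : ∀ n, IsSymmetric (P n)) (k : ℕ)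

variable (ν) in
/-- The ingredients given by the law of `colour ∅` and the conditional distributions of the parts
`colour e`; the colour in `K` of a `(k + 1)`-set `e` is the colour of `e` itself in `colour e`. -/
noncomputable def arrayIngredients : Ingredients (k + 1) K where
  Z _ := Finset ℕ → K
  μ₀ := ν.map (colour ∅)
  isProbabilityMeasure := Measure.isProbabilityMeasure_map (measurable_colour _).aemeasurable
  P i := P (i + 1)
  isMarkov i := inferInstance
  symm i := hsymm (i + 1)
  top := (P (k + 1)).map fun y => y ∅
  isMarkov_top := Kernel.IsMarkovKernel.map _ (measurable_pi_apply _)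
  symm_top σ z := by
    have hev : Measurable fun y : Finset ℕ → K => y ∅ := measurable_pi_apply _
    rw [Kernel.map_apply _ hev, Kernel.map_apply _ hev, hsymm (k + 1) σ z]

variable [Countable S] [Nonempty K]

theorem law_arrayIngredients
  (hν : ∀ f : S ⊕ ℕ ↪ S ⊕ ℕ, ν.map (reindex f) = ν)
    (hP : ∀ (n : ℕ) (ι : Fin n ↪ S),
      ν.map (fun x => (Lower.pull ι (lowerColours n x), colour (Finset.univ.map ι) x)) =
        ν.map (fun x => Lower.pull ι (lowerColours n x)) ⊗ₘ P n)
    (n : ℕ) :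
    (arrayIngredients ν P hsymm k).law S (n + 1) = ν.map (lowerColours (n + 1)) := by
  induction n with
  | zero => exact map_lowerColours_one
  | succ n ih =>
    have hstep : (ν.map (lowerColours (n + 1)) ⊗ₘ edgeKernel S (P (n + 1))).map Lower.snoc =
        ν.map (lowerColours (n + 2)) := by
      have hmeas := (measurable_lowerColours (S := S) (K := K) (n + 1)).prodMk
        (measurable_colours (n + 1))
      rw [← map_lowerColours_prod hν (P (n + 1)) (hP (n + 1)),
        Measure.map_map Lower.measurable_snoc hmeas]
      exact congrArg (fun F => ν.map F) (funext (snoc_lowerColours (n + 1)))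
    rw [← hstep, ← ih]
    rfl

theorem recipe_arrayIngredients
  (hν : ∀ f : S ⊕ ℕ ↪ S ⊕ ℕ, ν.map (reindex f) = ν)
    (hP : ∀ (n : ℕ) (ι : Fin n ↪ S),
      ν.map (fun x => (Lower.pull ι (lowerColours n x), colour (Finset.univ.map ι) x)) =
        ν.map (fun x => Lower.pull ι (lowerColours n x)) ⊗ₘ P n) :
    (arrayIngredients ν P hsymm k).recipe S =
      ν.map fun x (e : Set.powersetCard S (k + 1)) => colour (e : Finset S) x ∅ := by
  have hev : Measurable fun y : Finset ℕ → K => y ∅ := measurable_pi_apply _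
  have hev' : Measurable fun (y : Set.powersetCard S (k + 1) → Finset ℕ → K) e => y e ∅ := by
    fun_prop
  have hM : IsMarkovKernel ((P (k + 1)).map fun y => y ∅) := Kernel.IsMarkovKernel.map _ hev
  have hL := measurable_lowerColours (S := S) (K := K) (k + 1)
  have := Measure.isProbabilityMeasure_map hL.aemeasurable (μ := ν)
  unfold Ingredients.recipe
  rw [law_arrayIngredients P hsymm k hν hP]
  change (ν.map (lowerColours (k + 1))).bind
    (edgeKernel S ((P (k + 1)).map fun y => y ∅)) = _
  rw [edgeKernel_map S (P (k + 1)) hev, ← Measure.map_comp _ _ hev',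
    ← Measure.snd_compProd, ← map_lowerColours_prod hν (P (k + 1)) (hP (k + 1)),
    Measure.snd_map_prodMk hL, Measure.map_map hev' (measurable_colours _)]
  rfl

end Array

end ExchHyp

theorem theorem2p9 {S : Type v} [Countable S] [Infinite S] {K : Type u} [MeasurableSpace K]
    [StandardBorelSpace K] (k : ℕ) (hk : 1 ≤ k) (μ : Measure (Set.powersetCard S k → K))
    (hμ : ExchHyp.IsExchangeable μ) :
    ∃ I : ExchHyp.Ingredients k K, I.Yields μ := by
  have := hμ.isProbabilityMeasure
  obtain ⟨k, rfl⟩ : ∃ l, k = l + 1 := ⟨k - 1, by omega⟩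
  obtain ⟨ω⟩ := nonempty_of_isProbabilityMeasure μ
  obtain ⟨e₀⟩ : Nonempty (Set.powersetCard S (k + 1)) := inferInstance
  have : Nonempty K := ⟨ω e₀⟩
  obtain ⟨φ⟩ : Nonempty (S ⊕ ℕ ≃ S) := nonempty_equiv_of_countable
  have hext := ExchHyp.measurable_extend (k := k + 1) φ.toEmbedding (ω e₀)
  have := Measure.isProbabilityMeasure_map hext.aemeasurable (μ := μ)
  have hν := hμ.map_reindex_extend φ (ω e₀)
  choose P hMarkov hsymm hP using ExchHyp.exists_isSymmetric_kernel hν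
  refine ⟨ExchHyp.arrayIngredients _ P hsymm k,
    (ExchHyp.recipe_arrayIngredients P hsymm k hν hP).trans ?_⟩
  have hmeas : Measurable fun (x : Finset (S ⊕ ℕ) → K) (e : Set.powersetCard S (k + 1)) =>
      ExchHyp.colour (e : Finset S) x ∅ := by
    unfold ExchHyp.colour
    fun_prop
  rw [Measure.map_map hmeas hext]
  refine Eq.trans ?_ (hμ.map_relabel_embedding (Function.Embedding.inl.trans φ.toEmbedding))
  exact congrArg (fun F => μ.map F) (funext (ExchHyp.colour_extend _ _))
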